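/- Let $\mathcal H$ be a complex separable Hilbert space and let $T\neq 0$ be a bounded linear operator on $\mathcal H$. Write $|T|=(T^*T)^{1/2}$, let $\|\cdot\|$ be the operator norm, and let $\mathcal I$ be the set of all partial isometries on $\mathcal H$, i.e. of all bounded operators $X$ with $XX^*X=X$. Let $V$ be the polar factor of $T$, i.e. the unique $V\in\mathcal I$ such that $T=V|T|$ and $\ker V=\ker T$, and let $$\gamma(T)=\inf\{\|T\xi\| : \xi\in\ker(T)^{\perp},\ \|\xi\|=1\}$$ be the reduced minimum modulus of $T$. Then the following conditions are equivalent: (i) $\|T\|-1\ge 1-\gamma(T)$, or $\gamma(T)\ge \tfrac12$; (ii) $\|T-V\|=\min\{\|T-X\| : X\in\mathcal I\}$. -/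

import Mathlib

/-- A bounded operator `X` on a Hilbert space is a partial isometry if `X X* X = X`. -/
def IsPartialIsometry {H : Type*} [NormedAddCommGroup H] [InnerProductSpace ℂ H] [CompleteSpace H]
    (X : H →L[ℂ] H) : Prop :=
  X * star X * X = X

/-- `V` is the polar factor of `T`: the (unique) partial isometry with `T = V |T|` and
`ker V = ker T`, where `|T| = (T* T)^{1/2}`. -/
structure IsPolarFactor {H : Type*} [NormedAddCommGroup H] [InnerProductSpace ℂ H]
    [CompleteSpace H] (T V : H →L[ℂ] H) : Prop where
  isPartialIsometry : IsPartialIsometry V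
  eq_mul_abs : T = V * CFC.abs T
  ker_eq : V.ker = T.ker

/-- The reduced minimum modulus `γ(T) = inf {‖T ξ‖ : ξ ∈ (ker T)ᗮ, ‖ξ‖ = 1}` of a bounded
operator `T ≠ 0`. For `T ≠ 0` the set is nonempty and bounded below by `0`. -/
noncomputable def reducedMinModulus {H : Type*} [NormedAddCommGroup H] [InnerProductSpace ℂ H]
    (T : H →L[ℂ] H) : ℝ :=
  sInf {r : ℝ | ∃ ξ : H, ξ ∈ T.kerᗮ ∧ ‖ξ‖ = 1 ∧ r = ‖T ξ‖}

/-! ### Order and norm estimates in a C*-algebra -/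

section CStarAlgebra

variable {A : Type*} [CStarAlgebra A] [PartialOrder A] [StarOrderedRing A]

/-! Write γ for the reduced minimum modulus. Since |T| lies between γ and ‖T‖ on (ker T)ᗮ, ‖T - V‖ ≤
max (‖T‖ - 1) (1 - γ). Any partial isometry X has ‖T - X‖ ≥ ‖T‖ - 1, and either ‖T - X‖ ≥ γ or ‖T -
X‖ ≥ 1 - γ (`IsPartialIsometry.one_sub_reducedMinModulus_le`); under (i) this makes V optimal. If
(i) fails, cutting V down to the part where |T| exceeds 1/2 gives a partial isometry within max (‖T‖
- 1) (1/2) of T (`IsPolarFactor.exists_isPartialIsometry_norm_sub_le`), strictly less than 1 - γ ≤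
‖T - V‖. -/

theorem norm_le_of_neg_smul_one_le_of_le_smul_one {a : A} (ha : IsSelfAdjoint a) {m : ℝ}
    (hm : 0 ≤ m) (h₁ : -(m • (1 : A)) ≤ a) (h₂ : a ≤ m • (1 : A)) : ‖a‖ ≤ m := by
  cases subsingleton_or_nontrivial A
  · simpa [Subsingleton.elim a 0] using hm
  rw [← Algebra.algebraMap_eq_smul_one] at h₁ h₂
  rw [← map_neg] at h₁
  rw [le_algebraMap_iff_spectrum_le] at h₂
  rw [algebraMap_le_iff_le_spectrum] at h₁
  rcases CStarAlgebra.norm_or_neg_norm_mem_spectrum (a := a) with h | h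
  · exact h₂ _ h
  · linarith [h₁ _ h]

/-- The square root is operator monotone, and `r • e` is the root of `r ^ 2 • e`. -/
theorem IsStarProjection.smul_le_of_sq_smul_le {a e : A} (he : IsStarProjection e) (ha : 0 ≤ a)
    {r : ℝ} (hr : 0 ≤ r) (h : r ^ 2 • e ≤ a * a) : r • e ≤ a := by
  have h0 : 0 ≤ r • e := smul_nonneg hr he.nonneg
  have h1 := CFC.sqrt_le_sqrt _ _ h
  rw [CFC.sqrt_mul_self a ha] at h1
  have h2 : (r • e) * (r • e) = r ^ 2 • e := by
    rw [smul_mul_smul_comm, he.isIdempotentElem.eq, sq]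
  rwa [← h2, CFC.sqrt_mul_self _ h0] at h1

theorem IsStarProjection.le_norm_smul_of_mul_eq {a e : A} (he : IsStarProjection e) (ha : 0 ≤ a)
    (h₁ : a * e = a) (h₂ : e * a = a) : a ≤ ‖a‖ • e := by
  have h := he.isSelfAdjoint.conjugate_le_conjugate (IsSelfAdjoint.le_algebraMap_norm_self
    (IsSelfAdjoint.of_nonneg ha))
  rwa [h₂, h₁, Algebra.algebraMap_eq_smul_one, mul_smul_comm, mul_one, smul_mul_assoc,
    he.isIdempotentElem.eq] at h

theorem IsStarProjection.norm_sub_le_of_smul_le {a e : A} (he : IsStarProjection e) (ha : 0 ≤ a)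
    (h₁ : a * e = a) (h₂ : e * a = a) {r : ℝ} (hr : r ≤ ‖a‖) (h : r • e ≤ a) :
    ‖a - e‖ ≤ max (‖a‖ - 1) (1 - r) := by
  set m := max (‖a‖ - 1) (1 - r)
  have hm₁ : ‖a‖ - 1 ≤ m := le_max_left _ _
  have hm₂ : 1 - r ≤ m := le_max_right _ _
  have hm : 0 ≤ m := by linarith
  have he1 : m • e ≤ m • (1 : A) := smul_le_smul_of_nonneg_left he.le_one hm
  refine norm_le_of_neg_smul_one_le_of_le_smul_one
    ((IsSelfAdjoint.of_nonneg ha).sub he.isSelfAdjoint) hm ?_ ?_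
  · have h3 : (1 - r) • e ≤ m • e := smul_le_smul_of_nonneg_right hm₂ he.nonneg
    calc -(m • (1 : A)) ≤ -((1 - r) • e) := neg_le_neg (h3.trans he1)
      _ = r • e - e := by module
      _ ≤ a - e := sub_le_sub_right h e
  · have h3 : (‖a‖ - 1) • e ≤ m • e := smul_le_smul_of_nonneg_right hm₁ he.nonneg
    calc a - e ≤ ‖a‖ • e - e := sub_le_sub_right (he.le_norm_smul_of_mul_eq ha h₁ h₂) e
      _ = (‖a‖ - 1) • e := by module
      _ ≤ m • (1 : A) := h3.trans he1

/-- By commutation `a` is block diagonal along `f`: on `f` the difference lies between -1/2 and `‖a‖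
- 1`, off `f` between 0 and 1/2. -/
theorem IsStarProjection.norm_sub_le_of_commute {a f : A} (hf : IsStarProjection f) (ha : 0 ≤ a)
    (hc : Commute f a) (h₁ : (1 / 2 : ℝ) • f ≤ f * a * f)
    (h₂ : (1 - f) * a * (1 - f) ≤ (1 / 2 : ℝ) • (1 - f)) :
    ‖a - f‖ ≤ max (‖a‖ - 1) (1 / 2) := by
  set m := max (‖a‖ - 1) (1 / 2)
  have hm₁ : ‖a‖ - 1 ≤ m := le_max_left _ _
  have hm₂ : 1 / 2 ≤ m := le_max_right _ _
  have hm : 0 ≤ m := by linarith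
  have hff := hf.isIdempotentElem.eq
  have hdec : a = f * a * f + (1 - f) * a * (1 - f) := by
    have : f * a * f = f * a := by rw [hc.eq, mul_assoc, hff]
    have h' : f * a = a * f := hc.eq
    simp only [sub_mul, mul_sub, one_mul, mul_one, this]
    rw [h']
    abel
  have hfaf : f * a * f ≤ ‖a‖ • f := by
    have h := hf.isSelfAdjoint.conjugate_le_conjugate (IsSelfAdjoint.le_algebraMap_norm_self
      (IsSelfAdjoint.of_nonneg ha))
    rwa [Algebra.algebraMap_eq_smul_one, mul_smul_comm, mul_one, smul_mul_assoc, hff] at h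
  have hpos : 0 ≤ (1 - f) * a * (1 - f) := hf.one_sub.isSelfAdjoint.conjugate_nonneg ha
  refine norm_le_of_neg_smul_one_le_of_le_smul_one
    ((IsSelfAdjoint.of_nonneg ha).sub hf.isSelfAdjoint) hm ?_ ?_
  · have he1 : m • f ≤ m • (1 : A) := smul_le_smul_of_nonneg_left hf.le_one hm
    have h3 : (1 / 2 : ℝ) • f ≤ m • f := smul_le_smul_of_nonneg_right hm₂ hf.nonneg
    calc -(m • (1 : A)) ≤ -((1 / 2 : ℝ) • f) := neg_le_neg (h3.trans he1)
      _ = (1 / 2 : ℝ) • f + 0 - f := by module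
      _ ≤ f * a * f + (1 - f) * a * (1 - f) - f := sub_le_sub_right (add_le_add h₁ hpos) f
      _ = a - f := by rw [← hdec]
  · calc a - f = f * a * f + (1 - f) * a * (1 - f) - f := by rw [← hdec]
      _ ≤ ‖a‖ • f + (1 / 2 : ℝ) • (1 - f) - f := sub_le_sub_right (add_le_add hfaf h₂) f
      _ = (‖a‖ - 1) • f + (1 / 2 : ℝ) • (1 - f) := by module
      _ ≤ m • f + m • (1 - f) := add_le_add (smul_le_smul_of_nonneg_right hm₁ hf.nonneg)
          (smul_le_smul_of_nonneg_right hm₂ hf.one_sub_nonneg)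
      _ = m • (1 : A) := by module

/-- Compressing `h` by `1 - e`, which `a` annihilates, forces `(1 - e) * f * (1 - e) = 0`. -/
theorem IsStarProjection.mul_eq_left_of_smul_le {a e f : A} (he : IsStarProjection e)
    (hf : IsStarProjection f) (hc : Commute f a) (hae : a * e = a) {c : ℝ} (hc0 : 0 < c)
    (h : c • f ≤ f * a * f) : f * e = f := by
  have hz : f * a * f * (1 - e) = 0 := by
    rw [hc.eq, mul_assoc a, hf.isIdempotentElem.eq, ← hc.eq, mul_assoc, mul_sub, hae, mul_one,
      sub_self, mul_zero]
  have h1 := he.one_sub.isSelfAdjoint.conjugate_le_conjugate h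
  rw [mul_assoc _ (f * a * f), hz, mul_zero, mul_smul_comm, smul_mul_assoc] at h1
  have h2 : (1 - e) * f * (1 - e) ≤ 0 := by
    have := smul_le_smul_of_nonneg_left h1 (inv_nonneg.2 hc0.le)
    rwa [smul_smul, inv_mul_cancel₀ hc0.ne', one_smul, smul_zero] at this
  have h3 : (1 - e) * f * (1 - e) = 0 :=
    le_antisymm h2 (he.one_sub.isSelfAdjoint.conjugate_nonneg hf.nonneg)
  have h4 : star (f * (1 - e)) * (f * (1 - e)) = 0 := by
    rw [star_mul, hf.isSelfAdjoint.star_eq, he.one_sub.isSelfAdjoint.star_eq, mul_assoc,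
      ← mul_assoc f, hf.isIdempotentElem.eq, ← mul_assoc, h3]
  have h5 := (CStarRing.star_mul_self_eq_zero_iff _).1 h4
  rw [mul_sub, mul_one, sub_eq_zero] at h5
  exact h5.symm

end CStarAlgebra

/-! ### Spectral cut of a self-adjoint operator -/

section Operator

variable {H : Type*} [NormedAddCommGroup H] [InnerProductSpace ℂ H] [CompleteSpace H]

/-- The support projection of the positive part of `a - c` serves as the spectral projection of `a`
for (c, ∞), so no Borel functional calculus is needed. -/
theorem exists_isStarProjection_smul_le {a : H →L[ℂ] H} (ha : IsSelfAdjoint a) (c : ℝ) :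
    ∃ f : H →L[ℂ] H, IsStarProjection f ∧ Commute f a ∧ c • f ≤ f * a * f ∧
      (1 - f) * a * (1 - f) ≤ c • (1 - f) := by
  set s : H →L[ℂ] H := a - c • (1 : H →L[ℂ] H) with hs
  have hsa : IsSelfAdjoint s := ha.sub ((IsSelfAdjoint.all c).smul (IsSelfAdjoint.one _))
  have hdec : s⁺ - s⁻ = s := CFC.posPart_sub_negPart s hsa
  have hb0 : 0 ≤ s⁺ := CFC.posPart_nonneg s
  have hn0 : 0 ≤ s⁻ := CFC.negPart_nonneg s
  have hbn : s⁺ * s⁻ = 0 := CFC.posPart_mul_negPart s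
  set b := s⁺
  set n := s⁻
  set f : H →L[ℂ] H := b.kerᗮ.starProjection with hfdef
  have hf : IsStarProjection f := isStarProjection_starProjection
  have hff := hf.isIdempotentElem.eq
  have hbf : b * f = b := by
    ext x
    have h1 : x - f x ∈ b.kerᗮᗮ := Submodule.sub_starProjection_mem_orthogonal x
    rw [Submodule.orthogonal_orthogonal] at h1
    have h2 : b (x - f x) = 0 := h1
    rw [map_sub, sub_eq_zero] at h2
    exact h2.symm
  have hfb : f * b = b := by
    have := congrArg star hbf
    rwa [star_mul, hf.isSelfAdjoint.star_eq, (IsSelfAdjoint.of_nonneg hb0).star_eq] at this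
  have hfn : f * n = 0 := by
    ext x
    have h1 : n x ∈ b.ker := by
      have := congrArg (fun t : H →L[ℂ] H => t x) hbn
      exact this
    have h2 : n x ∈ b.kerᗮᗮ := Submodule.le_orthogonal_orthogonal _ h1
    exact Submodule.starProjection_apply_eq_zero_iff _ |>.2 h2
  have hnf : n * f = 0 := by
    have := congrArg star hfn
    rwa [star_mul, hf.isSelfAdjoint.star_eq, (IsSelfAdjoint.of_nonneg hn0).star_eq,
      star_zero] at this
  have ha' : a = b - n + c • (1 : H →L[ℂ] H) := by rw [hdec, hs]; abel
  have hfa : f * a = b + c • f := by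
    rw [ha', mul_add, mul_sub, hfb, hfn, sub_zero, mul_smul_comm, mul_one]
  have haf : a * f = b + c • f := by
    rw [ha', add_mul, sub_mul, hbf, hnf, sub_zero, smul_mul_assoc, one_mul]
  refine ⟨f, hf, hfa.trans haf.symm, ?_, ?_⟩
  · rw [hfa, add_mul, hbf, smul_mul_assoc, hff]
    exact le_add_of_nonneg_left hb0
  · have : (1 - f) * a * (1 - f) = c • (1 - f) - n := by
      have h1 : (1 - f) * a = c • (1 - f) - n := by
        rw [sub_mul, one_mul, hfa, ha', smul_sub]; abel
      rw [h1, sub_mul, smul_mul_assoc, hf.one_sub.isIdempotentElem.eq, mul_sub n, hnf, mul_one,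
        sub_zero]
    rw [this]
    exact sub_le_self _ hn0

theorem ContinuousLinearMap.norm_apply_eq_of_star_mul_self_eq {S R : H →L[ℂ] H}
    (h : star S * S = star R * R) (x : H) : ‖S x‖ = ‖R x‖ := by
  have h1 : ∀ Q : H →L[ℂ] H, ‖Q x‖ ^ 2 = RCLike.re (inner ℂ ((star Q * Q) x) x) := fun Q =>
    ContinuousLinearMap.apply_norm_sq_eq_inner_adjoint_left Q x
  have h2 : ‖S x‖ ^ 2 = ‖R x‖ ^ 2 := by rw [h1, h1, h]
  exact (sq_eq_sq₀ (norm_nonneg _) (norm_nonneg _)).1 h2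

/-! ### Partial isometries -/

namespace IsPartialIsometry

variable {X : H →L[ℂ] H}

theorem isStarProjection (hX : IsPartialIsometry X) : IsStarProjection (star X * X) where
  isIdempotentElem := by
    change star X * X * (star X * X) = star X * X
    rw [mul_assoc, ← mul_assoc X, hX]
  isSelfAdjoint := IsSelfAdjoint.star_mul_self X

theorem norm_apply_eq (hX : IsPartialIsometry X) (x : H) : ‖X x‖ = ‖(star X * X) x‖ := by
  refine ContinuousLinearMap.norm_apply_eq_of_star_mul_self_eq ?_ x
  rw [hX.isStarProjection.isSelfAdjoint.star_eq, hX.isStarProjection.isIdempotentElem.eq]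

theorem norm_le_one (hX : IsPartialIsometry X) : ‖X‖ ≤ 1 := by
  refine X.opNorm_le_bound zero_le_one fun x => ?_
  rw [hX.norm_apply_eq]
  exact ContinuousLinearMap.le_of_opNorm_le _ (IsStarProjection.norm_le _ hX.isStarProjection) x

theorem star_mul_self_apply_of_mem (hX : IsPartialIsometry X) {x : H} (hx : x ∈ X.kerᗮ) :
    (star X * X) x = x := by
  have h1 : x - (star X * X) x ∈ X.ker := by
    change X (x - (star X * X) x) = 0
    have h2 : X ((star X * X) x) = X x := congrArg (fun t : H →L[ℂ] H => t x) hX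
    rw [map_sub, h2, sub_self]
  have h2 : (star X * X) x ∈ X.kerᗮ := by
    rw [ContinuousLinearMap.orthogonal_ker]
    exact Submodule.le_topologicalClosure _ ⟨X x, rfl⟩
  have h3 : x - (star X * X) x ∈ X.kerᗮ := sub_mem hx h2
  have h4 := inner_self_eq_zero.1 (h3 _ h1)
  exact (sub_eq_zero.1 h4).symm

theorem norm_apply_of_mem (hX : IsPartialIsometry X) {x : H} (hx : x ∈ X.kerᗮ) :
    ‖X x‖ = ‖x‖ := by
  rw [hX.norm_apply_eq, hX.star_mul_self_apply_of_mem hx]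

theorem of_mul_isStarProjection {f : H →L[ℂ] H}
    (hf : IsStarProjection f) (h : f * (star X * X) = f) : IsPartialIsometry (X * f) := by
  have hff := hf.isIdempotentElem.eq
  rw [IsPartialIsometry, star_mul, hf.isSelfAdjoint.star_eq]
  calc X * f * (f * star X) * (X * f) = X * (f * f * (star X * X)) * f := by noncomm_ring
    _ = X * f := by rw [hff, h, mul_assoc, hff]

end IsPartialIsometry

/-! ### Reduced minimum modulus -/

omit [CompleteSpace H] in
theorem reducedMinModulus_le {T : H →L[ℂ] H} {x : H} (hx : x ∈ T.kerᗮ) (h1 : ‖x‖ = 1) :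
    reducedMinModulus T ≤ ‖T x‖ :=
  csInf_le ⟨0, by rintro r ⟨y, -, -, rfl⟩; exact norm_nonneg _⟩ ⟨x, hx, h1, rfl⟩

omit [CompleteSpace H] in
theorem reducedMinModulus_mul_norm_le {T : H →L[ℂ] H} {x : H} (hx : x ∈ T.kerᗮ) :
    reducedMinModulus T * ‖x‖ ≤ ‖T x‖ := by
  rcases eq_or_ne x 0 with rfl | h0
  · simp
  have hn : 0 < ‖x‖ := norm_pos_iff.2 h0
  have hu : ‖((‖x‖⁻¹ : ℝ) : ℂ) • x‖ = 1 := by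
    rw [norm_smul, Complex.norm_real, norm_inv, norm_norm, inv_mul_cancel₀ hn.ne']
  have h := reducedMinModulus_le (T.kerᗮ.smul_mem ((‖x‖⁻¹ : ℝ) : ℂ) hx) hu
  rw [map_smul, norm_smul, Complex.norm_real, norm_inv, norm_norm] at h
  rw [inv_mul_eq_div, le_div_iff₀ hn] at h
  exact h

theorem exists_mem_orthogonal_ker_norm_eq_one {T : H →L[ℂ] H} (hT : T ≠ 0) :
    ∃ x ∈ T.kerᗮ, ‖x‖ = 1 := by
  have hne : T.kerᗮ ≠ ⊥ := by
    intro h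
    rw [Submodule.orthogonal_eq_bot_iff] at h
    apply hT
    ext x
    have : x ∈ T.ker := h ▸ Submodule.mem_top
    exact this
  obtain ⟨x, hx, h0⟩ := Submodule.exists_mem_ne_zero_of_ne_bot hne
  have hn : 0 < ‖x‖ := norm_pos_iff.2 h0
  refine ⟨((‖x‖⁻¹ : ℝ) : ℂ) • x, T.kerᗮ.smul_mem _ hx, ?_⟩
  rw [norm_smul, Complex.norm_real, norm_inv, norm_norm, inv_mul_cancel₀ hn.ne']

theorem le_reducedMinModulus {T : H →L[ℂ] H} (hT : T ≠ 0) {c : ℝ}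
    (h : ∀ x ∈ T.kerᗮ, ‖x‖ = 1 → c ≤ ‖T x‖) : c ≤ reducedMinModulus T := by
  obtain ⟨x, hx, h1⟩ := exists_mem_orthogonal_ker_norm_eq_one hT
  refine le_csInf ⟨_, x, hx, h1, rfl⟩ ?_
  rintro r ⟨y, hy, hy1, rfl⟩
  exact h y hy hy1

omit [CompleteSpace H] in
theorem reducedMinModulus_nonneg (T : H →L[ℂ] H) : 0 ≤ reducedMinModulus T :=
  Real.sInf_nonneg (by rintro r ⟨y, -, -, rfl⟩; exact norm_nonneg _)

theorem reducedMinModulus_le_norm {T : H →L[ℂ] H} (hT : T ≠ 0) : reducedMinModulus T ≤ ‖T‖ := by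
  obtain ⟨x, hx, h1⟩ := exists_mem_orthogonal_ker_norm_eq_one hT
  exact (reducedMinModulus_le hx h1).trans (T.unit_le_opNorm x h1.le)

theorem norm_cfcAbs_apply (T : H →L[ℂ] H) (x : H) : ‖CFC.abs T x‖ = ‖T x‖ := by
  refine ContinuousLinearMap.norm_apply_eq_of_star_mul_self_eq ?_ x
  rw [(IsSelfAdjoint.of_nonneg (CFC.abs_nonneg T)).star_eq, CFC.abs_mul_abs]

theorem norm_cfcAbs_eq (T : H →L[ℂ] H) : ‖CFC.abs T‖ = ‖T‖ :=
  le_antisymm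
    ((CFC.abs T).opNorm_le_bound (norm_nonneg _) fun x => norm_cfcAbs_apply T x ▸ T.le_opNorm x)
    (T.opNorm_le_bound (norm_nonneg _) fun x => norm_cfcAbs_apply T x ▸ (CFC.abs T).le_opNorm x)

/-! ### Distance from an operator to its polar factor -/

namespace IsPolarFactor

variable {T V : H →L[ℂ] H}

theorem abs_mul_star_mul_self (hV : IsPolarFactor T V) : CFC.abs T * (star V * V) = CFC.abs T := by
  ext x
  have h1 : x - (star V * V) x ∈ T.ker := by
    rw [← hV.ker_eq]
    change V (x - (star V * V) x) = 0
    have h2 : V ((star V * V) x) = V x :=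
      congrArg (fun t : H →L[ℂ] H => t x) hV.isPartialIsometry
    rw [map_sub, h2, sub_self]
  have h2 : T (x - (star V * V) x) = 0 := h1
  have h3 : CFC.abs T (x - (star V * V) x) = 0 := by
    rw [← norm_eq_zero, norm_cfcAbs_apply, h2, norm_zero]
  rw [map_sub, sub_eq_zero] at h3
  exact h3.symm

theorem star_mul_self_mul_abs (hV : IsPolarFactor T V) : star V * V * CFC.abs T = CFC.abs T := by
  have := congrArg star hV.abs_mul_star_mul_self
  rwa [star_mul, (IsSelfAdjoint.star_mul_self V).star_eq,
    (IsSelfAdjoint.of_nonneg (CFC.abs_nonneg T)).star_eq] at this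

theorem norm_sub_mul_le (hV : IsPolarFactor T V) (f : H →L[ℂ] H) :
    ‖T - V * f‖ ≤ ‖CFC.abs T - f‖ := by
  have h : T - V * f = V * (CFC.abs T - f) := by rw [mul_sub, ← hV.eq_mul_abs]
  rw [h]
  exact (norm_mul_le _ _).trans
    (mul_le_of_le_one_left (norm_nonneg _) hV.isPartialIsometry.norm_le_one)

/-- As quadratic forms this is γ‖Vx‖ ≤ ‖Tx‖, the modulus bound at the projection of x to (ker T)ᗮ.
-/
theorem sq_smul_star_mul_self_le (hV : IsPolarFactor T V) :
    reducedMinModulus T ^ 2 • (star V * V) ≤ CFC.abs T * CFC.abs T := by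
  have hE := hV.isPartialIsometry.isStarProjection
  set g := reducedMinModulus T
  have hg : 0 ≤ g := reducedMinModulus_nonneg T
  have hA := IsSelfAdjoint.of_nonneg (CFC.abs_nonneg T)
  rw [ContinuousLinearMap.le_def, ContinuousLinearMap.isPositive_iff_complex]
  have hsa : IsSelfAdjoint (CFC.abs T * CFC.abs T - g ^ 2 • (star V * V)) := by
    refine IsSelfAdjoint.sub ?_ ((IsSelfAdjoint.all _).smul hE.isSelfAdjoint)
    rw [CFC.abs_mul_abs]
    exact IsSelfAdjoint.star_mul_self T
  intro x
  refine ⟨hsa.isSymmetric.coe_re_inner_apply_self x, ?_⟩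
  have hmem : (star V * V) x ∈ T.kerᗮ := by
    rw [← hV.ker_eq, ContinuousLinearMap.orthogonal_ker]
    exact Submodule.le_topologicalClosure _ ⟨V x, rfl⟩
  have h1 := reducedMinModulus_mul_norm_le hmem
  have h2 : ‖T ((star V * V) x)‖ = ‖T x‖ := by
    rw [← norm_cfcAbs_apply T, ← norm_cfcAbs_apply T]
    exact congrArg (fun t : H →L[ℂ] H => ‖t x‖) hV.abs_mul_star_mul_self
  rw [h2, ← hV.isPartialIsometry.norm_apply_eq] at h1
  have h3 : ∀ Q : H →L[ℂ] H, RCLike.re (inner ℂ ((star Q * Q) x) x) = ‖Q x‖ ^ 2 := fun Q =>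
    (ContinuousLinearMap.apply_norm_sq_eq_inner_adjoint_left Q x).symm
  have h4 : RCLike.re (inner ℂ ((CFC.abs T * CFC.abs T - g ^ 2 • (star V * V)) x) x)
      = ‖T x‖ ^ 2 - g ^ 2 * ‖V x‖ ^ 2 := by
    rw [CFC.abs_mul_abs, sub_apply, inner_sub_left, map_sub, h3,
      smul_apply, inner_smul_left_eq_smul, RCLike.smul_re, h3]
  rw [h4, ← mul_pow, sub_nonneg]
  exact pow_le_pow_left₀ (mul_nonneg hg (norm_nonneg _)) h1 2

theorem norm_sub_le (hT : T ≠ 0) (hV : IsPolarFactor T V) :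
    ‖T - V‖ ≤ max (‖T‖ - 1) (1 - reducedMinModulus T) := by
  have hE := hV.isPartialIsometry.isStarProjection
  have h1 := hV.norm_sub_mul_le (star V * V)
  have hVE : V * (star V * V) = V := by rw [← mul_assoc]; exact hV.isPartialIsometry
  rw [hVE] at h1
  have h2 := hE.norm_sub_le_of_smul_le (CFC.abs_nonneg T) hV.abs_mul_star_mul_self
    hV.star_mul_self_mul_abs (r := reducedMinModulus T)
    (by rw [norm_cfcAbs_eq]; exact reducedMinModulus_le_norm hT)
    (hE.smul_le_of_sq_smul_le (CFC.abs_nonneg T) (reducedMinModulus_nonneg T)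
      hV.sq_smul_star_mul_self_le)
  rw [norm_cfcAbs_eq] at h2
  exact h1.trans h2

theorem one_sub_reducedMinModulus_le (hT : T ≠ 0) (hV : IsPolarFactor T V) :
    1 - reducedMinModulus T ≤ ‖T - V‖ := by
  have : 1 - ‖T - V‖ ≤ reducedMinModulus T := by
    refine le_reducedMinModulus hT fun x hx h1 => ?_
    have h2 : ‖V x‖ = 1 := by
      rw [hV.isPartialIsometry.norm_apply_of_mem (hV.ker_eq ▸ hx), h1]
    have h3 := (T - V).unit_le_opNorm x h1.le
    have h4 := norm_sub_norm_le (V x) (T x)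
    rw [norm_sub_rev] at h4
    rw [sub_apply] at h3
    linarith
  linarith

/-- Round the spectrum of |T| to 1 above 1/2 and to 0 below; rounding up or down then costs at most
1/2, except for values above 1. -/
theorem exists_isPartialIsometry_norm_sub_le (hV : IsPolarFactor T V) :
    ∃ X : H →L[ℂ] H, IsPartialIsometry X ∧ ‖T - X‖ ≤ max (‖T‖ - 1) (1 / 2) := by
  have hA := CFC.abs_nonneg T
  obtain ⟨f, hf, hc, h1, h2⟩ :=
    exists_isStarProjection_smul_le (IsSelfAdjoint.of_nonneg hA) (1 / 2)
  have hfe := hV.isPartialIsometry.isStarProjection.mul_eq_left_of_smul_le hf hc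
    hV.abs_mul_star_mul_self one_half_pos h1
  refine ⟨V * f, IsPartialIsometry.of_mul_isStarProjection hf hfe, ?_⟩
  refine (hV.norm_sub_mul_le f).trans ?_
  have h := hf.norm_sub_le_of_commute hA hc h1 h2
  rwa [norm_cfcAbs_eq] at h

end IsPolarFactor

/-! ### Lower bounds for arbitrary partial isometries -/

theorem IsPartialIsometry.norm_sub_one_le {X : H →L[ℂ] H} (hX : IsPartialIsometry X)
    (T : H →L[ℂ] H) : ‖T‖ - 1 ≤ ‖T - X‖ := by
  linarith [norm_sub_norm_le T X, hX.norm_le_one]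

/-- If `X` is closer to `T` than the reduced minimum modulus, then `ker X ∩ (ker T)ᗮ` is trivial,
so the projection of `(ker X)ᗮ` to `(ker T)ᗮ` is dense. -/
theorem orthogonal_ker_le_topologicalClosure_map {T X : H →L[ℂ] H}
    (h : ‖T - X‖ < reducedMinModulus T) :
    T.kerᗮ ≤ (X.kerᗮ.map (T.kerᗮ.starProjection : H →ₗ[ℂ] H)).topologicalClosure := by
  set K := X.kerᗮ.map (T.kerᗮ.starProjection : H →ₗ[ℂ] H)
  rw [← Submodule.orthogonal_orthogonal_eq_closure]
  intro x hx
  rw [Submodule.mem_orthogonal]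
  intro y hy
  have hPy : T.kerᗮ.starProjection y ∈ T.kerᗮ := Submodule.starProjection_apply_mem _ y
  have hXy : T.kerᗮ.starProjection y ∈ X.ker := by
    rw [← Submodule.orthogonal_orthogonal X.ker, Submodule.mem_orthogonal]
    intro z hz
    rw [← Submodule.inner_starProjection_left_eq_right]
    exact hy _ ⟨z, hz, rfl⟩
  have hXy' : X (T.kerᗮ.starProjection y) = 0 := hXy
  have h1 := reducedMinModulus_mul_norm_le hPy
  have h2 := (T - X).le_opNorm (T.kerᗮ.starProjection y)
  rw [sub_apply, hXy', sub_zero] at h2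
  -- The projected vector p lies in ker X, so γ‖p‖ ≤ ‖Tp‖ ≤ ‖T - X‖‖p‖ with ‖T - X‖ < γ.
  have h3 : ‖T.kerᗮ.starProjection y‖ = 0 := by
    by_contra h0
    have : 0 < ‖T.kerᗮ.starProjection y‖ := lt_of_le_of_ne (norm_nonneg _) (Ne.symm h0)
    nlinarith
  rw [← Submodule.starProjection_eq_self_iff.2 hx, ← Submodule.inner_starProjection_left_eq_right,
    norm_eq_zero.1 h3, inner_zero_left]

/-- For z in (ker X)ᗮ, ‖Tz‖ ≥ (1 - ‖T - X‖)‖z‖. Projecting z to (ker T)ᗮ keeps Tz and does not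
increase the norm, so the bound survives; density of these projections extends it to (ker T)ᗮ. -/
theorem IsPartialIsometry.one_sub_reducedMinModulus_le {T X : H →L[ℂ] H} (hT : T ≠ 0)
    (hX : IsPartialIsometry X) (h : ‖T - X‖ < reducedMinModulus T) :
    1 - reducedMinModulus T ≤ ‖T - X‖ := by
  suffices 1 - ‖T - X‖ ≤ reducedMinModulus T by linarith
  rcases le_total (1 - ‖T - X‖) 0 with hc | hc
  · exact hc.trans (reducedMinModulus_nonneg T)
  set c := 1 - ‖T - X‖ with hcdef
  refine le_reducedMinModulus hT fun x hx h1 => ?_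
  have hclosed : IsClosed {y : H | c * ‖y‖ ≤ ‖T y‖} :=
    isClosed_le (by fun_prop) (by fun_prop)
  have hsub : (X.kerᗮ.map (T.kerᗮ.starProjection : H →ₗ[ℂ] H) : Set H) ⊆
      {y : H | c * ‖y‖ ≤ ‖T y‖} := by
    rintro _ ⟨z, hz, rfl⟩
    change c * ‖T.kerᗮ.starProjection z‖ ≤ ‖T (T.kerᗮ.starProjection z)‖
    have hTz : T (T.kerᗮ.starProjection z) = T z := by
      have h2 : z - T.kerᗮ.starProjection z ∈ T.kerᗮᗮ :=
        Submodule.sub_starProjection_mem_orthogonal z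
      rw [Submodule.orthogonal_orthogonal] at h2
      have h3 : T (z - T.kerᗮ.starProjection z) = 0 := h2
      rw [map_sub, sub_eq_zero] at h3
      exact h3.symm
    have h2 : ‖X z‖ = ‖z‖ := hX.norm_apply_of_mem hz
    have h3 := (T - X).le_opNorm z
    rw [sub_apply] at h3
    have h4 := norm_sub_norm_le (X z) (T z)
    rw [norm_sub_rev] at h4
    rw [hTz]
    calc c * ‖T.kerᗮ.starProjection z‖ ≤ c * ‖z‖ :=
          mul_le_mul_of_nonneg_left (Submodule.norm_starProjection_apply_le _ z) hc
      _ ≤ ‖T z‖ := by rw [hcdef, sub_mul, one_mul]; linarith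
  have h2 : c * ‖x‖ ≤ ‖T x‖ :=
    closure_minimal hsub hclosed (orthogonal_ker_le_topologicalClosure_map h hx)
  rwa [h1, mul_one] at h2

end Operator

theorem proposition2p5 {H : Type*} [NormedAddCommGroup H] [InnerProductSpace ℂ H]
    [CompleteSpace H] [TopologicalSpace.SeparableSpace H]
    (T V : H →L[ℂ] H) (hT : T ≠ 0) (hV : IsPolarFactor T V) :
    (‖T‖ - 1 ≥ 1 - reducedMinModulus T ∨ reducedMinModulus T ≥ 1 / 2) ↔
      IsLeast {d : ℝ | ∃ X : H →L[ℂ] H, IsPartialIsometry X ∧ d = ‖T - X‖} ‖T - V‖ := by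
  constructor
  · intro h
    refine ⟨⟨V, hV.isPartialIsometry, rfl⟩, ?_⟩
    rintro d ⟨X, hX, rfl⟩
    refine (hV.norm_sub_le hT).trans ?_
    rcases le_or_gt (1 - reducedMinModulus T) (‖T‖ - 1) with h1 | h1
    · rw [max_eq_left h1]
      exact hX.norm_sub_one_le T
    · rw [max_eq_right h1.le]
      have h2 : reducedMinModulus T ≥ 1 / 2 := by
        rcases h with h | h <;> linarith
      rcases lt_or_ge ‖T - X‖ (reducedMinModulus T) with h3 | h3
      · exact hX.one_sub_reducedMinModulus_le hT h3
      · linarith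
  · rintro ⟨-, h⟩
    by_contra! hcon
    obtain ⟨X, hX, hle⟩ := hV.exists_isPartialIsometry_norm_sub_le
    have h1 := h ⟨X, hX, rfl⟩
    have h2 := hV.one_sub_reducedMinModulus_le hT
    have h3 := max_lt hcon.1 (show (1 / 2 : ℝ) < 1 - reducedMinModulus T by linarith [hcon.2])
    linarith
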